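/- Let $n,m$ be integers with $1\le m<n-1$ and $\gcd(n,m)=1$. A complex polynomial is called Schur stable if all its roots lie in the open unit disc $\{|z|<1\}$. Let $$\Omega_n=\{[1:b:c]\in\mathbb{P}^2_{\mathbb{C}} : \zeta^n+b\zeta^m+c \text{ is Schur stable}\},$$ and let $\Pi_n([1:b:c])=[1:|b|:(-1)^n|c|]\in\mathbb{P}^2_{\mathbb{R}}$ for $b,c\in\mathbb{C}$, where $\mathbb{P}^2_{\mathbb{R}}$ is regarded as a subset of $\mathbb{P}^2_{\mathbb{C}}$. Let $b,c\in\mathbb{C}$ satisfy $|b|=1$ and $0<|c|<1$. Then $$\Pi_n([1:b:c])=[1:1:(-1)^n|c|]\notin\Omega_n \quad\text{and}\quad [1:b:c]\notin\Omega_n;$$ that is, the trinomial $\zeta^n+b\zeta^m+c$ is not Schur stable. -/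

import Mathlib

namespace SchurTrinomial

open Polynomial

/-- A complex polynomial is Schur stable if all its roots lie in the open unit disc. -/
def IsSchurStable (p : ℂ[X]) : Prop :=
  ∀ z : ℂ, p.IsRoot z → ‖z‖ < 1

/-- The trinomial `a ζ ^ n + b ζ ^ m + c`. -/
noncomputable def trinomial (n m : ℕ) (a b c : ℂ) : ℂ[X] :=
  C a * X ^ n + C b * X ^ m + C c

/-- The projective plane over a field `K`. -/
abbrev Plane (K : Type*) [Field K] : Type _ :=
  Projectivization K (Fin 3 → K)

theorem affine_ne_zero {K : Type*} [Field K] (x y : K) : (![1, x, y] : Fin 3 → K) ≠ 0 :=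
  fun h => one_ne_zero (congrFun h 0)

/-- The point `[1 : x : y]` of the projective plane over `K`. -/
def point {K : Type*} [Field K] (x y : K) : Plane K :=
  Projectivization.mk K ![1, x, y] (affine_ne_zero x y)

/-- The stability region `Ω_n`: the points `[1 : b : c]` of the complex projective plane for which
`ζ ^ n + b ζ ^ m + c` is a Schur stable trinomial. -/
def stabilityRegion (n m : ℕ) : Set (Plane ℂ) :=
  {p | ∃ b c : ℂ, p = point b c ∧ IsSchurStable (trinomial n m 1 b c)}

theorem modulus_ne_zero (n : ℕ) {v : Fin 3 → ℂ} (hv : v ≠ 0) :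
    (![‖v 0‖, ‖v 1‖, (-1) ^ n * ‖v 2‖] : Fin 3 → ℝ) ≠ 0 := by
  intro h
  apply hv
  have h0 : ‖v 0‖ = 0 := congrFun h 0
  have h1 : ‖v 1‖ = 0 := congrFun h 1
  have h2 : (-1) ^ n * ‖v 2‖ = 0 := congrFun h 2
  have h2' : v 2 = 0 := by simpa using h2
  funext i
  fin_cases i
  · simpa using h0
  · simpa using h1
  · simpa using h2'

/-- The projection `Π_n`, in homogeneous coordinates `[a : b : c] ↦ [|a| : |b| : (-1) ^ n |c|]`;
on points with `a = 1` it is `[1 : b : c] ↦ [1 : |b| : (-1) ^ n |c|]`. -/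
noncomputable def proj (n : ℕ) : Plane ℂ → Plane ℝ :=
  Projectivization.lift
    (fun v => Projectivization.mk ℝ
      ![‖(v : Fin 3 → ℂ) 0‖, ‖(v : Fin 3 → ℂ) 1‖, (-1) ^ n * ‖(v : Fin 3 → ℂ) 2‖]
      (modulus_ne_zero n v.2))
    (by
      intro a b t h
      rw [Projectivization.mk_eq_mk_iff']
      refine ⟨‖t‖, ?_⟩
      rw [h]
      funext i
      fin_cases i
      · simp
      · simp
      · simp [mul_left_comm])

/-- The coordinatewise inclusion of `ℝ ^ 3` in `ℂ ^ 3`. -/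
noncomputable def ofRealVec : (Fin 3 → ℝ) →ₛₗ[Complex.ofRealHom] (Fin 3 → ℂ) where
  toFun v i := (v i : ℂ)
  map_add' u v := by
    funext i
    simp
  map_smul' r v := by
    funext i
    simp

theorem ofRealVec_injective : Function.Injective ofRealVec := by
  intro u v h
  funext i
  exact Complex.ofReal_injective (congrFun h i)

/-- The inclusion of the real projective plane in the complex projective plane,
`[a : b : c] ↦ [a : b : c]`. -/
noncomputable def inclusion : Plane ℝ → Plane ℂ :=
  Projectivization.map ofRealVec ofRealVec_injective

end SchurTrinomial

namespace SchurTrinomial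

open Polynomial ComplexConjugate

/-! Schur–Cohn descent. For `p = a z^n + b z^m + c` with reciprocal `p*`, stability gives `|c| <
|a|` and `|p*| ≤ |p|` off the open disc, so `conj a * p - c * p*` has no zeros there. This
transform, divided by its power of `z`, is a trinomial of smaller degree. If `2m < n`, its constant
term is at least as large as its leading coefficient, which is absurd; if `2m > n`, `|a| ≤ |b|`
persists and induction applies. -/

theorem trinomial_eq (n m : ℕ) (a b c : ℂ) :
    trinomial n m a b c = Polynomial.trinomial 0 m n c b a := by
  rw [trinomial, Polynomial.trinomial]
  ring

theorem eval_trinomial (n m : ℕ) (a b c z : ℂ) :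
    (trinomial n m a b c).eval z = a * z ^ n + b * z ^ m + c := by
  simp [trinomial]

/-- The squares differ by `(|z|^2 - 1)(1 - |a|^2)`. -/
theorem norm_one_sub_conj_mul_le {z a : ℂ} (hz : 1 ≤ ‖z‖) (ha : ‖a‖ ≤ 1) :
    ‖1 - conj z * a‖ ≤ ‖z - a‖ := by
  refine le_of_sq_le_sq ?_ (norm_nonneg _)
  have hz' : 1 ≤ ‖z‖ ^ 2 := one_le_pow₀ hz
  have ha' : ‖a‖ ^ 2 ≤ 1 := pow_le_one₀ (norm_nonneg _) ha
  rw [← Complex.normSq_eq_norm_sq, Complex.normSq_apply] at *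
  rw [← Complex.normSq_eq_norm_sq, Complex.normSq_apply] at *
  simp only [Complex.sub_re, Complex.sub_im, Complex.mul_re, Complex.mul_im, Complex.conj_re,
    Complex.conj_im, Complex.one_re, Complex.one_im]
  nlinarith [mul_nonneg (sub_nonneg.2 hz') (sub_nonneg.2 ha')]

/-- Outside the unit disc a Schur stable polynomial dominates its reciprocal polynomial. -/
theorem IsSchurStable.norm_reciprocal_le {p : ℂ[X]} (hp : IsSchurStable p) (hp₀ : p ≠ 0) {z : ℂ}
    (hz : 1 ≤ ‖z‖) : ‖z‖ ^ p.natDegree * ‖p.eval (conj z)⁻¹‖ ≤ ‖p.eval z‖ := by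
  have hs := IsAlgClosed.splits p
  have hz₀ : z ≠ 0 := norm_pos_iff.1 (one_pos.trans_le hz)
  have key : ∀ s : Multiset ℂ, (∀ a ∈ s, ‖a‖ < 1) →
      ‖z‖ ^ s.card * ‖(s.map ((conj z)⁻¹ - ·)).prod‖ ≤ ‖(s.map (z - ·)).prod‖ := by
    intro s
    induction s using Multiset.induction with
    | empty => simp
    | cons a s ih =>
      intro h
      have h₁ : ‖z‖ * ‖(conj z)⁻¹ - a‖ ≤ ‖z - a‖ := by
        refine le_trans (le_of_eq ?_) (norm_one_sub_conj_mul_le hz (h a (by simp)).le)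
        rw [← Complex.norm_conj z, ← norm_mul, mul_sub, mul_inv_cancel₀ (by simpa using hz₀)]
      have h₂ := ih fun b hb => h b (Multiset.mem_cons_of_mem hb)
      simp only [Multiset.card_cons, Multiset.map_cons, Multiset.prod_cons, norm_mul, pow_succ']
      calc _ = (‖z‖ * ‖(conj z)⁻¹ - a‖) *
            (‖z‖ ^ s.card * ‖(s.map ((conj z)⁻¹ - ·)).prod‖) := by ring
        _ ≤ _ := by gcongr
  have h := key p.roots fun a ha => hp a ((mem_roots hp₀).1 ha)
  rw [hs.eval_eq_prod_roots, hs.eval_eq_prod_roots, hs.natDegree_eq_card_roots, norm_mul, norm_mul,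
    mul_left_comm]
  gcongr

/-- Up to sign, the constant term is the leading coefficient times the product of the roots. -/
theorem IsSchurStable.norm_coeff_zero_lt {p : ℂ[X]} (hp : IsSchurStable p)
    (hd : 0 < p.natDegree) : ‖p.coeff 0‖ < ‖p.leadingCoeff‖ := by
  have hs := IsAlgClosed.splits p
  have hp₀ : p ≠ 0 := ne_zero_of_natDegree_gt hd
  have key : ∀ s : Multiset ℂ, (∀ a ∈ s, ‖a‖ < 1) →
      ‖(s.map (0 - ·)).prod‖ ≤ 1 ∧ (s ≠ 0 → ‖(s.map (0 - ·)).prod‖ < 1) := by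
    intro s
    induction s using Multiset.induction with
    | empty => simp
    | cons a s ih =>
      intro h
      have h₂ := (ih fun b hb => h b (Multiset.mem_cons_of_mem hb)).1
      have h₁ := h a (by simp)
      simp only [Multiset.map_cons, Multiset.prod_cons, norm_mul, zero_sub, norm_neg] at h₂ ⊢
      have : ‖a‖ * ‖(s.map (- ·)).prod‖ < 1 :=
        mul_lt_one_of_nonneg_of_lt_one_left (norm_nonneg _) h₁ h₂
      exact ⟨this.le, fun _ => this⟩
  have hr : p.roots ≠ 0 := by
    rw [← Multiset.card_pos, ← hs.natDegree_eq_card_roots]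
    exact hd
  have h := (key p.roots fun a ha => hp a ((mem_roots hp₀).1 ha)).2 hr
  rw [coeff_zero_eq_eval_zero, hs.eval_eq_prod_roots, norm_mul]
  exact mul_lt_of_lt_one_right (by simpa using hp₀) h

theorem natDegree_trinomial {n m : ℕ} (hm : 0 < m) (hmn : m < n) {a : ℂ} (ha : a ≠ 0) (b c : ℂ) :
    (trinomial n m a b c).natDegree = n := by
  rw [trinomial_eq, Polynomial.trinomial_natDegree hm hmn ha]

theorem IsSchurStable.norm_const_lt {n m : ℕ} (hm : 0 < m) (hmn : m < n) {a b c : ℂ} (ha : a ≠ 0)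
    (h : IsSchurStable (trinomial n m a b c)) : ‖c‖ < ‖a‖ := by
  have := h.norm_coeff_zero_lt (by rw [natDegree_trinomial hm hmn ha]; omega)
  rwa [coeff_zero_eq_eval_zero, eval_trinomial, trinomial_eq,
    Polynomial.trinomial_leadingCoeff hm hmn ha, zero_pow (by omega), zero_pow (by omega), mul_zero,
    mul_zero, zero_add, zero_add] at this

/-- The Schur transform of a Schur stable trinomial has no zeros outside the open unit disc. -/
theorem IsSchurStable.norm_lt_one_of_schurTransform_eq_zero {n m : ℕ} (hm : 0 < m) (hmn : m < n)
    {a b c : ℂ} (ha : a ≠ 0) (h : IsSchurStable (trinomial n m a b c)) {z : ℂ}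
    (hz : (conj a * a - c * conj c) * z ^ n + conj a * b * z ^ m - c * conj b * z ^ (n - m) = 0) :
    ‖z‖ < 1 := by
  by_contra! hz₁
  have hz₀ : z ≠ 0 := norm_pos_iff.1 (one_pos.trans_le hz₁)
  have hd := natDegree_trinomial hm hmn ha b c
  have hp₀ : trinomial n m a b c ≠ 0 := ne_zero_of_natDegree_gt (hd ▸ hm.trans hmn)
  have hle := h.norm_reciprocal_le hp₀ hz₁
  rw [hd] at hle
  have hrec : ‖z‖ ^ n * ‖(trinomial n m a b c).eval (conj z)⁻¹‖ =
      ‖conj a + conj b * z ^ (n - m) + conj c * z ^ n‖ := by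
    rw [← norm_pow, ← Complex.norm_conj (eval _ _), ← norm_mul, eval_trinomial]
    congr 1
    simp only [map_add, map_mul, map_pow, map_inv₀, Complex.conj_conj, mul_add]
    rw [pow_sub₀ z hz₀ hmn.le, inv_pow, inv_pow]
    field_simp
  rw [hrec] at hle
  -- At a zero of the transform, `|a||p| = |c||p*| ≤ |c||p|`, against `|c| < |a|`.
  have heq : conj a * (trinomial n m a b c).eval z =
      c * (conj a + conj b * z ^ (n - m) + conj c * z ^ n) := by
    rw [eval_trinomial]
    linear_combination hz
  have hn := congrArg norm heq
  rw [norm_mul, norm_mul, Complex.norm_conj] at hn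
  have hpos : 0 < ‖(trinomial n m a b c).eval z‖ :=
    norm_pos_iff.2 fun h0 => (h z h0).not_ge hz₁
  have hca := h.norm_const_lt hm hmn ha
  nlinarith [mul_le_mul_of_nonneg_left hle (norm_nonneg c), mul_lt_mul_of_pos_right hca hpos]

/-- A general leading coefficient is needed because the transform is not monic; `|a| ≤ |b|` is the
invariant of the descent. -/
theorem not_isSchurStable_trinomial {n m : ℕ} (hm : 1 ≤ m) (hmn : m + 1 < n)
    (hgcd : Nat.Coprime n m) {a b c : ℂ} (ha : a ≠ 0) (hab : ‖a‖ ≤ ‖b‖) (hc : c ≠ 0) :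
    ¬ IsSchurStable (trinomial n m a b c) := by
  induction n using Nat.strong_induction_on generalizing m a b c with
  | _ n ih =>
  intro h
  have hca := h.norm_const_lt hm (by omega) ha
  have hT : ∀ z : ℂ, _ → ‖z‖ < 1 := fun z =>
    h.norm_lt_one_of_schurTransform_eq_zero hm (by omega) ha
  have hb : b ≠ 0 := norm_pos_iff.1 ((norm_pos_iff.2 ha).trans_le hab)
  have ha' : conj a * a - c * conj c = ((‖a‖ ^ 2 - ‖c‖ ^ 2 : ℝ) : ℂ) := by
    rw [Complex.conj_mul', Complex.mul_conj']
    push_cast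
    rfl
  have hsq : 0 < ‖a‖ ^ 2 - ‖c‖ ^ 2 := sub_pos.2 (pow_lt_pow_left₀ hca (norm_nonneg _) two_ne_zero)
  have ha₀ : conj a * a - c * conj c ≠ 0 := by
    rw [ha']
    exact_mod_cast hsq.ne'
  -- `|a|^2 - |c|^2 ≤ |a|^2 ≤ |a||b|`.
  have hab' : ‖conj a * a - c * conj c‖ ≤ ‖conj a * b‖ := by
    rw [ha', Complex.norm_real, Real.norm_of_nonneg hsq.le, norm_mul, Complex.norm_conj]
    nlinarith [norm_nonneg a, sq_nonneg ‖c‖]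
  have hc₀ : -(c * conj b) ≠ 0 := by simpa using ⟨hc, hb⟩
  rcases lt_trichotomy (2 * m) n with hlt | heq | hgt
  · obtain ⟨k, rfl⟩ : ∃ k, n = 2 * m + k := ⟨n - 2 * m, by omega⟩
    have hstab : IsSchurStable (trinomial (m + k) k (conj a * a - c * conj c) (-(c * conj b))
        (conj a * b)) := by
      intro z hz
      rw [IsRoot, eval_trinomial] at hz
      apply hT
      rw [show 2 * m + k - m = k + m by omega]
      linear_combination z ^ m * hz
    exact (hstab.norm_const_lt (by omega) (by omega) ha₀).not_ge hab'
  -- Coprimality leaves only `(n, m) = (2, 1)`, which `m + 1 < n` excludes.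
  · subst heq
    have : m = 1 := by rwa [Nat.Coprime, Nat.gcd_mul_left_left] at hgcd
    omega
  -- A Euclidean step `(n, m) ↦ (m, 2m - n)`: the gcd and the gap `k = n - m > 1` are preserved.
  · obtain ⟨k, rfl⟩ : ∃ k, n = m + k := ⟨n - m, by omega⟩
    obtain ⟨l, rfl⟩ : ∃ l, m = k + l := ⟨m - k, by omega⟩
    refine ih (k + l) (by omega) (by omega) (by omega) (by simpa using hgcd) ha₀ hab'
      hc₀ (show IsSchurStable (trinomial _ l _ _ _) from ?_)
    intro z hz
    rw [IsRoot, eval_trinomial] at hz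
    apply hT
    rw [show k + l + k - (k + l) = k by omega]
    linear_combination z ^ k * hz

theorem point_injective {K : Type*} [Field K] {x y x' y' : K} (h : point x y = point x' y') :
    x = x' ∧ y = y' := by
  obtain ⟨t, ht⟩ := (Projectivization.mk_eq_mk_iff' K _ _ _ _).1 h
  have h0 : t = 1 := by simpa using congrFun ht 0
  subst h0
  exact ⟨by simpa using (congrFun ht 1).symm, by simpa using (congrFun ht 2).symm⟩

theorem point_mem_stabilityRegion {n m : ℕ} {b c : ℂ} :
    point b c ∈ stabilityRegion n m ↔ IsSchurStable (trinomial n m 1 b c) := by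
  constructor
  · rintro ⟨b', c', h, hs⟩
    obtain ⟨rfl, rfl⟩ := point_injective h
    exact hs
  · exact fun h => ⟨b, c, rfl, h⟩

theorem proj_point (n : ℕ) (b c : ℂ) : proj n (point b c) = point ‖b‖ ((-1) ^ n * ‖c‖) := by
  simp [proj, point]

theorem inclusion_point (x y : ℝ) : inclusion (point x y) = point (x : ℂ) (y : ℂ) := by
  rw [inclusion, point, Projectivization.map_mk, point, Projectivization.mk_eq_mk_iff']
  refine ⟨1, ?_⟩
  funext i
  fin_cases i <;> simp [ofRealVec]

end SchurTrinomial

theorem corollary1p10 (n m : ℕ) (hm : 1 ≤ m) (hmn : m + 1 < n) (hgcd : Nat.gcd n m = 1)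
    (b c : ℂ) (hb : ‖b‖ = 1) (hc₀ : 0 < ‖c‖) (hc₁ : ‖c‖ < 1) :
    SchurTrinomial.proj n (SchurTrinomial.point b c) =
        SchurTrinomial.point (1 : ℝ) ((-1) ^ n * ‖c‖) ∧
      SchurTrinomial.inclusion (SchurTrinomial.point (1 : ℝ) ((-1) ^ n * ‖c‖)) ∉
        SchurTrinomial.stabilityRegion n m ∧
      SchurTrinomial.point b c ∉ SchurTrinomial.stabilityRegion n m ∧
      ¬ SchurTrinomial.IsSchurStable (SchurTrinomial.trinomial n m 1 b c) := by
  have hc : c ≠ 0 := norm_pos_iff.1 hc₀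
  have hbc : ¬ SchurTrinomial.IsSchurStable (SchurTrinomial.trinomial n m 1 b c) :=
    SchurTrinomial.not_isSchurStable_trinomial hm hmn hgcd one_ne_zero (by simp [hb]) hc
  refine ⟨?_, ?_, fun h => hbc (SchurTrinomial.point_mem_stabilityRegion.1 h), hbc⟩
  · rw [SchurTrinomial.proj_point, hb]
  · rw [SchurTrinomial.inclusion_point, SchurTrinomial.point_mem_stabilityRegion]
    exact SchurTrinomial.not_isSchurStable_trinomial hm hmn hgcd one_ne_zero (by simp)
      (by simpa using hc)
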